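/- Let $D$ be a finite set, $n\ge 0$, $\mathcal D\subseteq D^n$, and let $f:\mathcal D\to\{0,1\}$ be a boolean function. Put $F(x,y)=\delta_{f(x),f(y)}$, $\sigma_f(x,y)=(-1)^{f(x)+f(y)}$, $\Delta_i(x,y)=\delta_{x_i,y_i}$ for $x,y\in\mathcal D$ and $1\le i\le n$; let $I$ be the identity matrix, $J$ the all-ones matrix and $\circ$ the entrywise matrix product. The additive adversary bound of $F$ is $$\mathrm{ADV}(F)=\max\bigl\{\|\Gamma\circ(J-F)\| : \Gamma \text{ a Hermitian } |\mathcal D|\times|\mathcal D| \text{ matrix with } I\pm\Gamma\circ(J-\Delta_i)\succeq 0 \text{ for all } i\bigr\},$$ where $\|\cdot\|$ is the spectral norm. For an integer $k>0$ let $\oplus\circ f^{(k)}:\mathcal D^k\to\{0,1\}$, $(x^1,\dots,x^k)\mapsto f(x^1)\oplus\cdots\oplus f(x^k)$, and $\sigma_f^{\otimes k}(x,y)=\prod_{p}\sigma_f(x^p,y^p)$ for $x,y\in\mathcal D^k$. A $T$-query quantum algorithm on input $z$ prepares $U_TO_zU_{T-1}\cdots O_zU_0|\bar 0\rangle$ with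 input-independent unitaries $U_t$, where $O_z|i,b,w\rangle=|i,b+z_i,w\rangle$; here the query register $i$ ranges over the positions of the input and a null index on which $O_z$ is the identity, the work register $w$ is finite-dimensional of arbitrary size, and $b$ ranges over a finite abelian group in which the symbols of $D$ are encoded injectively (group and encoding are arbitrary, but fixed). $Q_\epsilon(g)$ is the minimum $T$ for which some $T$-query algorithm, followed by a measurement of its final state, outputs $g(z)$ with probability at least $1-\epsilon$ for every input $z$. $Q^c_\epsilon(\sigma)$ is the minimum $T$ for which there are a $T$-query algorithm with final states $|P(z)\rangle$ and vectors $|\tau_z\rangle$ in its state space with $\langle\tau_x|\tau_y\rangle=\sigma(x,y)$ for all inputs $x,y$, such that $\mathrm{Re}\,\langle P(z)|\tau_z\rangle\ge\sqrt{1-\epsilon}$ for every input $z$. Then for every $0\le\delta\le 1$ and every integer $k>0$: 1. (strong direct product theorem for computing $f$ in the phase) $\displaystyle Q^c_{1-\delta^k}\bigl(\sigma_f^{\otimes k}\bigr)\ \ge\ \frac{k\delta}{4}\,\mathrm{ADV}(F)$; 2. (XOR Lemma) $\displaystyle Q_{(1-\delta^{k/2})/2}\bigl(\oplus\circ f^{(k)}\bigr)\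 \ge\ \frac{k\delta}{8}\,\mathrm{ADV}(F)$. -/

import Mathlib

open scoped ENNReal Matrix ComplexOrder

noncomputable section

/-- Computational basis states `|i, b, w⟩` of a query algorithm: a query register `i` (an index
into the input string, or `none` for "no query"), an answer register `b` with values in a finite
abelian group `G`, and a work register of arbitrary finite size. -/
abbrev BasisState (ι G : Type*) (m : ℕ) : Type _ := Option ι × G × Fin (m + 1)

/-- The Hilbert space of the algorithm. -/
abbrev StateSpace (ι G : Type*) (m : ℕ) : Type _ := EuclideanSpace ℂ (BasisState ι G m)

/-- The permutation `|i, b, w⟩ ↦ |i, b + z_i, w⟩` of the basis states (`|none, b, w⟩` is fixed). -/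
def queryPerm {ι G : Type*} [AddCommGroup G] (m : ℕ) (z : ι → G) :
    Equiv.Perm (BasisState ι G m) where
  toFun s := (s.1, s.2.1 + s.1.elim 0 z, s.2.2)
  invFun s := (s.1, s.2.1 - s.1.elim 0 z, s.2.2)
  left_inv := by
    rintro ⟨i, b, w⟩
    simp
  right_inv := by
    rintro ⟨i, b, w⟩
    simp

/-- The oracle gate: the unitary which permutes the basis states by `queryPerm`. -/
def oracle {ι G : Type*} [Fintype ι] [Fintype G] [AddCommGroup G] (m : ℕ) (z : ι → G) :
    StateSpace ι G m ≃ₗᵢ[ℂ] StateSpace ι G m :=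
  LinearIsometryEquiv.piLpCongrLeft 2 ℂ ℂ (queryPerm m z)

/-- A quantum query algorithm: the size of its work register and the input-independent
unitaries `U₀, U₁, …`. When it is run with `T` queries only `U₀, …, U_T` matter. -/
structure QueryAlgorithm (ι G : Type*) [Fintype ι] [Fintype G] where
  workSize : ℕ
  gate : ℕ → (StateSpace ι G workSize ≃ₗᵢ[ℂ] StateSpace ι G workSize)

/-- The state `U_T O_z U_{T-1} O_z ⋯ O_z U₀ |none, 0, 0⟩` after `T` queries to the input string
`z`. -/
def QueryAlgorithm.state {ι G : Type*} [Fintype ι] [Fintype G] [AddCommGroup G]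
    (A : QueryAlgorithm ι G) (z : ι → G) : ℕ → StateSpace ι G A.workSize
  | 0 => by
      classical
      exact A.gate 0 (EuclideanSpace.single (none, 0, 0) 1)
  | T + 1 => A.gate (T + 1) (oracle A.workSize z (A.state z T))

/-- With `T` queries, for every input `x : X`, presented to the algorithm as the string
`enc ∘ str x`, the algorithm `A` outputs `g x` with probability at least `1 - ε`. The output is
obtained by measuring the final state in the computational basis and reading off the value `out`
of the outcome. -/
def ComputesWithError {X ι D G E : Type*} [Fintype ι] [Fintype G] [AddCommGroup G] [DecidableEq E]
    (enc : D ↪ G) (str : X → ι → D) (g : X → E) (ε : ℝ) (T : ℕ) : Prop :=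
  ∃ (A : QueryAlgorithm ι G) (out : BasisState ι G A.workSize → E),
    ∀ x : X, 1 - ε ≤
      ∑ s : BasisState ι G A.workSize with out s = g x, ‖A.state (fun i => enc (str x i)) T s‖ ^ 2

/-- The quantum query complexity `Q_ε(g)`: the least number of queries of an algorithm that
computes `g` with error at most `ε` on every input. -/
def quantumQuery {X ι D G E : Type*} [Fintype ι] [Fintype G] [AddCommGroup G] [DecidableEq E]
    (enc : D ↪ G) (str : X → ι → D) (g : X → E) (ε : ℝ) : ℕ∞ :=
  ⨅ (T : ℕ) (_ : ComputesWithError enc str g ε T), (T : ℕ∞)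

/-- With `T` queries, the state generation problem with target Gram matrix `σ` is solved coherently
with error at most `ε`: there are target vectors `τ_x` with `⟨τ_x, τ_y⟩ = σ(x, y)` in the final
space such that `Re ⟨P(x), τ_x⟩ ≥ √(1 - ε)` for the final states `P(x)`. The `τ_x` are fixed up to a
unitary by `σ`, so they may be thought of as `σ_x ⊗ 0̄` for a default workspace state `0̄`. -/
def GeneratesCoherently {X ι D G : Type*} [Fintype ι] [Fintype G] [AddCommGroup G]
    (enc : D ↪ G) (str : X → ι → D) (σ : Matrix X X ℂ) (ε : ℝ) (T : ℕ) : Prop :=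
  ∃ (A : QueryAlgorithm ι G) (τ : X → StateSpace ι G A.workSize),
    (∀ x y : X, inner ℂ (τ x) (τ y) = σ x y) ∧
    ∀ x : X, √(1 - ε) ≤ (inner ℂ (A.state (fun i => enc (str x i)) T) (τ x)).re

/-- The coherent quantum query complexity `Q^c_ε(σ)` of generating `σ`. -/
def coherentQuery {X ι D G : Type*} [Fintype ι] [Fintype G] [AddCommGroup G]
    (enc : D ↪ G) (str : X → ι → D) (σ : Matrix X X ℂ) (ε : ℝ) : ℕ∞ :=
  ⨅ (T : ℕ) (_ : GeneratesCoherently enc str σ ε T), (T : ℕ∞)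

/-- The all-ones matrix `J`. -/
def allOnes (X : Type*) : Matrix X X ℂ := fun _ _ => 1

/-- The matrix `Δ_i(x, y) = δ_{x_i, y_i}`. -/
def agreeMatrix {X ι D : Type*} [DecidableEq D] (str : X → ι → D) (i : ι) : Matrix X X ℂ :=
  fun x y => if str x i = str y i then 1 else 0

/-- The Gram matrix `F(x, y) = δ_{f(x), f(y)}`. -/
def functionGram {X E : Type*} [DecidableEq E] (f : X → E) : Matrix X X ℂ :=
  fun x y => if f x = f y then 1 else 0

/-- The Gram matrix `σ_f(x, y) = (-1)^{f(x) + f(y)}` of computing `f` in the phase. -/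
def phaseGram {X : Type*} (f : X → ZMod 2) : Matrix X X ℂ :=
  fun x y => (-1) ^ ((f x).val + (f y).val)

/-- The tensor power `σ^{⊗ k}`, with rows and columns indexed by `k`-tuples. -/
def tensorPower {X : Type*} (k : ℕ) (σ : Matrix X X ℂ) : Matrix (Fin k → X) (Fin k → X) ℂ :=
  fun x y => ∏ p, σ (x p) (y p)

/-- A `k`-tuple of inputs as one string, with positions `(p, i)`. -/
def tupleString {X ι D : Type*} (k : ℕ) (str : X → ι → D) (x : Fin k → X) : Fin k × ι → D :=
  fun q => str (x q.1) q.2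

/-- The parity `⊕ ∘ f^{(k)}` of `k` independent copies of `f`. -/
def parityOfCopies {X : Type*} (k : ℕ) (f : X → ZMod 2) (x : Fin k → X) : ZMod 2 :=
  ∑ p, f (x p)

/-- The additive adversary bound: the supremum of the spectral norms `‖Γ ∘ (J - σ)‖` over Hermitian
matrices `Γ` with `I ± Γ ∘ (J - Δ_i) ⪰ 0` for all `i`, where `∘` is the entrywise product. -/
def additiveAdversary {X ι D : Type*} [Fintype X] [DecidableEq X] [DecidableEq D]
    (str : X → ι → D) (σ : Matrix X X ℂ) : ℝ≥0∞ :=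
  ⨆ (Γ : Matrix X X ℂ)
    (_ : Γ.IsHermitian ∧ ∀ i : ι,
      (1 + Γ ⊙ (allOnes X - agreeMatrix str i)).PosSemidef ∧
      (1 - Γ ⊙ (allOnes X - agreeMatrix str i)).PosSemidef),
    ENNReal.ofReal ‖Matrix.toEuclideanCLM (𝕜 := ℂ) (Γ ⊙ (allOnes X - σ))‖

end

/-!
Let `A = Γ ∘ (J - F)` for an adversary matrix `Γ`. The progress function of the multiplicative
adversary method is `Re ∑ M(x, y) ⟨ψ_x, ψ_y⟩` for the states `ψ_x` of an algorithm and the weights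
`M = (I + γ (‖A‖ I - A))^{⊗ k}`. A query to one copy changes one tensor factor only, where the
constraints on `Γ` bound the growth, so that each query multiplies the progress by at most `1 + 2γ`.
As `A` vanishes where `f(x) = f(y)`, multiplication by the signs `(-1)^{f(x)}` exchanges its
eigenvalues `‖A‖` and `-‖A‖`. Starting in the eigenvector for `‖A‖`, of progress `1`, an algorithm
with squared overlap `δ^k` must therefore reach a progress of at least `(1 + 2γ ‖A‖)^k δ^k`. The
bound on the number of queries results from `γ` with `(1 + 2γ ‖A‖) δ = e`.

For the XOR lemma, an algorithm computing a bit is turned into one computing it in the phase by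
running it, flipping the phase according to the output, and running it backwards. This doubles the
number of queries.
-/

section

open Matrix

/-! ### The progress function -/

section Progress

variable {K H : Type*} [Fintype K] [NormedAddCommGroup H] [InnerProductSpace ℂ H]

/-- The progress function `M ↦ Re ∑ M(x, y) ⟨ψ_x, ψ_y⟩` of a family of states `ψ_x`, as a linear
function of the weight matrix `M`. -/
noncomputable def progress (ψ : K → H) : Matrix K K ℂ →ₗ[ℝ] ℝ where
  toFun M := (∑ x, ∑ y, M x y * inner ℂ (ψ x) (ψ y)).re
  map_add' M N := by
    simp only [Matrix.add_apply, add_mul, Finset.sum_add_distrib, Complex.add_re]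
  map_smul' c M := by
    simp only [Matrix.smul_apply, smul_mul_assoc, ← Finset.smul_sum, Complex.smul_re,
      RingHom.id_apply]

theorem progress_apply (ψ : K → H) (M : Matrix K K ℂ) :
    progress ψ M = (∑ x, ∑ y, M x y * inner ℂ (ψ x) (ψ y)).re := rfl

theorem progress_nonneg {M : Matrix K K ℂ} (hM : M.PosSemidef) (ψ : K → H) :
    0 ≤ progress ψ M := by
  have h := (hM.hadamard (posSemidef_gram ℂ ψ)).re_dotProduct_nonneg 1
  simpa [progress_apply, dotProduct, mulVec, gram_apply] using h

theorem progress_congr {H' : Type*} [NormedAddCommGroup H'] [InnerProductSpace ℂ H']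
    {M : Matrix K K ℂ} {ψ : K → H} {φ : K → H'}
    (h : ∀ x y, M x y ≠ 0 → inner ℂ (ψ x) (ψ y) = inner ℂ (φ x) (φ y)) :
    progress ψ M = progress φ M := by
  rw [progress_apply, progress_apply]
  congr 1
  refine Finset.sum_congr rfl fun x _ => Finset.sum_congr rfl fun y _ => ?_
  by_cases hxy : M x y = 0
  · rw [hxy, zero_mul, zero_mul]
  · rw [h x y hxy]

theorem progress_map_isometry (U : H ≃ₗᵢ[ℂ] H) (ψ : K → H) (M : Matrix K K ℂ) :
    progress (fun x => U (ψ x)) M = progress ψ M :=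
  progress_congr fun x y _ => U.inner_map_map (ψ x) (ψ y)

theorem progress_vecMulVec_self_star (w : K → ℂ) (ψ : K → H) :
    progress ψ (vecMulVec w (star w)) = ‖∑ x, star (w x) • ψ x‖ ^ 2 := by
  rw [progress_apply, ← inner_self_eq_norm_sq (𝕜 := ℂ), RCLike.re_to_complex, sum_inner]
  congr 1
  refine Finset.sum_congr rfl fun x _ => ?_
  rw [inner_sum]
  refine Finset.sum_congr rfl fun y _ => ?_
  simp only [vecMulVec_apply, Pi.star_apply, inner_smul_left, inner_smul_right, Complex.star_def,
    Complex.conj_conj]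
  ring

theorem progress_smul_const (v : K → ℂ) {e : H} (he : ‖e‖ = 1) (M : Matrix K K ℂ) :
    progress (fun x => v x • e) M = (star v ⬝ᵥ M *ᵥ v).re := by
  have hinner : inner ℂ e e = (1 : ℂ) := by simp [he]
  simp only [progress_apply, inner_smul_left, inner_smul_right, hinner, dotProduct, mulVec,
    Finset.mul_sum, Pi.star_apply, Complex.star_def]
  congr 1
  refine Finset.sum_congr rfl fun x _ => Finset.sum_congr rfl fun y _ => ?_
  ring

/-- The weights `M` dominate a matrix `R` supported on pairs with equal labels, and off these pairs
`M` coincides with a matrix `E` satisfying `-γ R ⪯ E ⪯ γ R`. The progress with such weights grows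
by at most a factor `1 + 2γ` when every `ψ_x` is moved by a unitary depending only on the label
of `x`. -/
def GrowthBounded {Y : Type*} (label : K → Y) (M : Matrix K K ℂ) (γ : ℝ) : Prop :=
  ∃ R E : Matrix K K ℂ, (M - R).PosSemidef ∧ (γ • R + E).PosSemidef ∧ (γ • R - E).PosSemidef ∧
    ∀ x y, label x ≠ label y → R x y = 0 ∧ M x y = E x y

theorem GrowthBounded.progress_le {Y : Type*} {label : K → Y} {M : Matrix K K ℂ} {γ : ℝ}
    (h : GrowthBounded label M γ) (hγ : 0 ≤ γ) (U : Y → H ≃ₗᵢ[ℂ] H) (ψ : K → H) :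
    progress (fun x => U (label x) (ψ x)) M ≤ (1 + 2 * γ) * progress ψ M := by
  obtain ⟨R, E, hRM, hadd, hsub, hsupp⟩ := h
  set φ : K → H := fun x => U (label x) (ψ x) with hφ
  have unchanged : ∀ N : Matrix K K ℂ, (∀ x y, label x ≠ label y → N x y = 0) →
      progress φ N = progress ψ N := fun N hN => progress_congr fun x y hxy => by
    have hlabel : label x = label y := not_imp_comm.mp (hN x y) hxy
    simp only [hφ, hlabel, LinearIsometryEquiv.inner_map_map]
  have hR : progress φ R = progress ψ R := unchanged R fun x y hxy => (hsupp x y hxy).1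
  have hME : progress φ (M - E) = progress ψ (M - E) :=
    unchanged (M - E) fun x y hxy => sub_eq_zero.mpr (hsupp x y hxy).2
  have hφE := progress_nonneg hsub φ
  have hψE := progress_nonneg hadd ψ
  have hψR := mul_nonneg hγ (progress_nonneg hRM ψ)
  simp only [map_add, map_sub, map_smul, smul_eq_mul, hR] at hME hφE hψE hψR
  linarith

theorem posSemidef_sub_smul_vecMulVec_of_mulVec_eq {M : Matrix K K ℂ} (hM : M.PosSemidef)
    {w : K → ℂ} (hw : star w ⬝ᵥ w = 1) {μ : ℝ} (hMw : M *ᵥ w = μ • w) :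
    (M - μ • vecMulVec w (star w)).PosSemidef := by
  classical
  set P := vecMulVec w (star w) with hP
  have hPadj : Pᴴ = P := by rw [hP, conjTranspose_vecMulVec, star_star]
  have hPP : P * P = P := by rw [hP, vecMulVec_mul_vecMulVec, hw, one_smul]
  have hMP : M * P = μ • P := by rw [hP, mul_vecMulVec, hMw, smul_vecMulVec]
  have hPM : P * M = μ • P := by
    simpa [conjTranspose_mul, hPadj, hM.isHermitian.eq] using congrArg conjTranspose hMP
  have heq : (1 - P)ᴴ * M * (1 - P) = M - μ • P := by
    simp only [conjTranspose_sub, conjTranspose_one, hPadj, sub_mul, mul_sub, one_mul, mul_one,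
      hPM, hMP, Matrix.smul_mul, hPP, sub_self, sub_zero]
  exact heq ▸ hM.conjTranspose_mul_mul_same (1 - P)

theorem star_mul_self_of_norm_eq_one {z : ℂ} (hz : ‖z‖ = 1) : star z * z = 1 := by
  simp [Complex.conj_mul', hz]

theorem star_mul_dotProduct_mul_of_norm_eq_one {u : K → ℂ} (hu : ∀ x, ‖u x‖ = 1) (v : K → ℂ) :
    star (u * v) ⬝ᵥ (u * v) = star v ⬝ᵥ v := by
  refine Finset.sum_congr rfl fun x _ => ?_
  have hux := star_mul_self_of_norm_eq_one (hu x)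
  simp only [Pi.star_apply, Pi.mul_apply, star_mul']
  linear_combination star (v x) * v x * hux

theorem mul_sq_le_progress_of_overlap {M : Matrix K K ℂ} (hM : M.PosSemidef) {u v : K → ℂ}
    (hu : ∀ x, ‖u x‖ = 1) (hv : star v ⬝ᵥ v = 1) {μ : ℝ} (hμ : 0 ≤ μ)
    (hMuv : M *ᵥ (u * v) = μ • (u * v)) {ψ : K → H} {τ : H} (hτ : ‖τ‖ = 1) {c : ℝ} (hc : 0 ≤ c)
    (hψ : ∀ x, c ≤ (inner ℂ (ψ x) (u x • τ)).re) :
    μ * c ^ 2 ≤ progress (fun x => v x • ψ x) M := by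
  set Φ : H := ∑ x, star ((u * v) x) • v x • ψ x with hΦ
  have hprogress : μ * ‖Φ‖ ^ 2 ≤ progress (fun x => v x • ψ x) M := by
    have hw := (star_mul_dotProduct_mul_of_norm_eq_one hu v).trans hv
    have h := progress_nonneg (posSemidef_sub_smul_vecMulVec_of_mulVec_eq hM hw hMuv)
      fun x => v x • ψ x
    rwa [map_sub, map_smul, progress_vecMulVec_self_star, smul_eq_mul, sub_nonneg] at h
  have hinner : (inner ℂ Φ τ).re = ∑ x, ‖v x‖ ^ 2 * (inner ℂ (ψ x) (u x • τ)).re := by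
    rw [hΦ, sum_inner, Complex.re_sum]
    refine Finset.sum_congr rfl fun x _ => ?_
    rw [← Complex.re_ofReal_mul, Complex.ofReal_pow, ← Complex.conj_mul']
    simp only [inner_smul_left, inner_smul_right, Pi.mul_apply, Complex.star_def, Complex.conj_conj]
    ring_nf
  have hweights : ∑ x, ‖v x‖ ^ 2 = 1 := by
    exact_mod_cast (by simpa [dotProduct, Complex.conj_mul'] using hv : ∑ x, (‖v x‖ : ℂ) ^ 2 = 1)
  have hcΦ : c ≤ ‖Φ‖ := calc
    c = ∑ x, ‖v x‖ ^ 2 * c := by rw [← Finset.sum_mul, hweights, one_mul]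
    _ ≤ (inner ℂ Φ τ).re := hinner ▸ Finset.sum_le_sum fun x _ => by gcongr; exact hψ x
    _ ≤ ‖inner ℂ Φ τ‖ := Complex.re_le_norm _
    _ ≤ ‖Φ‖ * ‖τ‖ := norm_inner_le_norm _ _
    _ = ‖Φ‖ := by rw [hτ, mul_one]
  calc μ * c ^ 2 ≤ μ * ‖Φ‖ ^ 2 := by gcongr
    _ ≤ _ := hprogress

end Progress

/-! ### Tensor powers -/

section Tensor

variable {X : Type*} {k : ℕ}

/-- The product of the tensor factors of `M^{⊗ k}` with index in `s`, the other factors being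
replaced by the all-ones matrix. -/
def tensorPowerOn (s : Finset (Fin k)) (M : Matrix X X ℂ) : Matrix (Fin k → X) (Fin k → X) ℂ :=
  fun x y => ∏ q ∈ s, M (x q) (y q)

/-- The tensor product with `N` as its `p`-th factor and `M` as each of the other `k - 1` factors,
as a linear function of `N`. -/
def tensorReplace (p : Fin k) (M : Matrix X X ℂ) :
    Matrix X X ℂ →ₗ[ℝ] Matrix (Fin k → X) (Fin k → X) ℂ where
  toFun N := N.submatrix (· p) (· p) ⊙ tensorPowerOn (Finset.univ.erase p) M
  map_add' _ _ := add_hadamard _ _ _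
  map_smul' c N := smul_hadamard (N.submatrix _ _) _ c

theorem tensorReplace_apply (p : Fin k) (M N : Matrix X X ℂ) (x y : Fin k → X) :
    tensorReplace p M N x y = N (x p) (y p) * tensorPowerOn (Finset.univ.erase p) M x y := rfl

theorem tensorReplace_self (p : Fin k) (M : Matrix X X ℂ) :
    tensorReplace p M M = tensorPower k M := by
  ext x y
  exact Finset.mul_prod_erase Finset.univ (fun q => M (x q) (y q)) (Finset.mem_univ p)

theorem allOnes_eq_vecMulVec (X : Type*) : allOnes X = vecMulVec 1 (star 1) := by
  ext x y
  simp [allOnes, vecMulVec_apply]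

theorem tensorPowerOn_insert (M : Matrix X X ℂ) {p : Fin k} {s : Finset (Fin k)} (hp : p ∉ s) :
    tensorPowerOn (insert p s) M = M.submatrix (· p) (· p) ⊙ tensorPowerOn s M := by
  ext x y
  exact Finset.prod_insert hp

section PosSemidef

variable [Finite X] {M N : Matrix X X ℂ}

theorem posSemidef_tensorPowerOn (hM : M.PosSemidef) (s : Finset (Fin k)) :
    (tensorPowerOn s M).PosSemidef := by
  induction s using Finset.induction_on with
  | empty =>
    have hempty : tensorPowerOn ∅ M = allOnes (Fin k → X) := rfl
    rw [hempty, allOnes_eq_vecMulVec]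
    exact posSemidef_vecMulVec_self_star 1
  | insert p s hp ih =>
    rw [tensorPowerOn_insert M hp]
    exact (hM.submatrix _).hadamard ih

theorem posSemidef_tensorPower (hM : M.PosSemidef) (k : ℕ) : (tensorPower k M).PosSemidef :=
  posSemidef_tensorPowerOn hM Finset.univ

theorem posSemidef_tensorReplace (hM : M.PosSemidef) (hN : N.PosSemidef) (p : Fin k) :
    (tensorReplace p M N).PosSemidef :=
  (hN.submatrix _).hadamard (posSemidef_tensorPowerOn hM _)

end PosSemidef

/-- The tensor power `v^{⊗ k}` of a vector, with entries indexed by `k`-tuples. -/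
def tensorPowerVec (k : ℕ) (v : X → ℂ) : (Fin k → X) → ℂ := fun x => ∏ p, v (x p)

theorem tensorPowerVec_mul (u v : X → ℂ) :
    tensorPowerVec k (u * v) = tensorPowerVec k u * tensorPowerVec k v :=
  funext fun _ => Finset.prod_mul_distrib

theorem tensorPowerVec_smul (c : ℝ) (v : X → ℂ) :
    tensorPowerVec k (c • v) = c ^ k • tensorPowerVec k v := by
  ext x
  simp [tensorPowerVec, Finset.prod_mul_distrib]

theorem star_tensorPowerVec (v : X → ℂ) :
    star (tensorPowerVec k v) = tensorPowerVec k (star v) :=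
  funext fun _ => star_prod _ _

theorem tensorPower_vecMulVec (u v : X → ℂ) :
    tensorPower k (vecMulVec u v) = vecMulVec (tensorPowerVec k u) (tensorPowerVec k v) := by
  ext x y
  exact Finset.prod_mul_distrib

theorem norm_tensorPowerVec_apply {u : X → ℂ} (hu : ∀ a, ‖u a‖ = 1) (x : Fin k → X) :
    ‖tensorPowerVec k u x‖ = 1 := by
  simp [tensorPowerVec, norm_prod, hu]

variable [Fintype X]

theorem tensorPower_mulVec_tensorPowerVec (M : Matrix X X ℂ) (v : X → ℂ) :
    tensorPower k M *ᵥ tensorPowerVec k v = tensorPowerVec k (M *ᵥ v) := by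
  ext x
  simp only [mulVec, dotProduct, tensorPower, tensorPowerVec, ← Finset.prod_mul_distrib]
  exact (Fintype.prod_sum fun p b => M (x p) b * v b).symm

theorem tensorPowerVec_dotProduct_tensorPowerVec (u v : X → ℂ) :
    tensorPowerVec k u ⬝ᵥ tensorPowerVec k v = (u ⬝ᵥ v) ^ k := by
  simp only [dotProduct, tensorPowerVec, ← Finset.prod_mul_distrib]
  exact (Fintype.sum_pow (fun a => u a * v a) k).symm

end Tensor

/-! ### Extremal eigenvectors of Hermitian matrices -/

section Spectral

open scoped Matrix.Norms.L2Operator MatrixOrder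

variable {X : Type*} [Fintype X] [DecidableEq X]

theorem posSemidef_norm_smul_one_sub {A : Matrix X X ℂ} (hA : A.IsHermitian) :
    (‖toEuclideanCLM (𝕜 := ℂ) A‖ • (1 : Matrix X X ℂ) - A).PosSemidef := by
  have h : A ≤ algebraMap ℝ (Matrix X X ℂ) ‖A‖ :=
    IsSelfAdjoint.le_algebraMap_norm_self (isHermitian_iff_isSelfAdjoint.mp hA)
  rwa [Algebra.algebraMap_eq_smul_one, Matrix.le_iff] at h

theorem exists_mulVec_eq_smul_of_mem_spectrum {A : Matrix X X ℂ} (hA : A.IsHermitian) {c : ℝ}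
    (hc : c ∈ spectrum ℝ A) : ∃ v : X → ℂ, star v ⬝ᵥ v = 1 ∧ A *ᵥ v = c • v := by
  rw [hA.spectrum_real_eq_range_eigenvalues] at hc
  obtain ⟨i, rfl⟩ := hc
  refine ⟨hA.eigenvectorBasis i, ?_, hA.mulVec_eigenvectorBasis i⟩
  rw [dotProduct_comm, ← EuclideanSpace.inner_eq_star_dotProduct]
  simp

theorem exists_mulVec_eq_norm_smul_or_neg [Nonempty X] {A : Matrix X X ℂ} (hA : A.IsHermitian) :
    ∃ v : X → ℂ, star v ⬝ᵥ v = 1 ∧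
      (A *ᵥ v = ‖toEuclideanCLM (𝕜 := ℂ) A‖ • v ∨
        A *ᵥ v = (-‖toEuclideanCLM (𝕜 := ℂ) A‖) • v) := by
  rcases CStarAlgebra.norm_or_neg_norm_mem_spectrum (isHermitian_iff_isSelfAdjoint.mp hA)
    with h | h <;>
  obtain ⟨v, hv, hAv⟩ := exists_mulVec_eq_smul_of_mem_spectrum hA h
  · exact ⟨v, hv, Or.inl hAv⟩
  · exact ⟨v, hv, Or.inr hAv⟩

end Spectral

/-! ### Progress of a query algorithm -/

section Algorithm

section Slice

variable {O S K : Type*} [Fintype O] [Fintype S] [Fintype K]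

/-- The component `(⟨o| ⊗ I) ψ` of a bipartite vector at the basis state `|o⟩` of the first
register. -/
def slice (o : O) (ψ : EuclideanSpace ℂ (O × S)) : EuclideanSpace ℂ S :=
  WithLp.toLp 2 fun s => ψ (o, s)

theorem inner_eq_sum_inner_slice (ψ φ : EuclideanSpace ℂ (O × S)) :
    inner ℂ ψ φ = ∑ o, inner ℂ (slice o ψ) (slice o φ) := by
  simp only [PiLp.inner_apply, Fintype.sum_prod_type]
  rfl

theorem progress_eq_sum_progress_slice (ψ : K → EuclideanSpace ℂ (O × S)) (M : Matrix K K ℂ) :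
    progress ψ M = ∑ o, progress (fun x => slice o (ψ x)) M := by
  simp only [progress_apply, ← Complex.re_sum, inner_eq_sum_inner_slice (ψ _), Finset.mul_sum]
  rw [Finset.sum_comm (s := (Finset.univ : Finset O))]
  exact congrArg Complex.re (Finset.sum_congr rfl fun x _ => Finset.sum_comm)

end Slice

variable {ι G : Type*} [Fintype ι] [Fintype G] [AddCommGroup G]

/-- The unitary `|b, w⟩ ↦ |b + a, w⟩` on the answer and work registers. -/
noncomputable def answerShift (m : ℕ) (a : G) :
    EuclideanSpace ℂ (G × Fin (m + 1)) ≃ₗᵢ[ℂ] EuclideanSpace ℂ (G × Fin (m + 1)) :=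
  LinearIsometryEquiv.piLpCongrLeft 2 ℂ ℂ ((Equiv.addRight a).prodCongr (Equiv.refl _))

theorem slice_oracle (m : ℕ) (z : ι → G) (o : Option ι) (ψ : StateSpace ι G m) :
    slice o (oracle m z ψ) = answerShift m (o.elim 0 z) (slice o ψ) := by
  ext s
  exact congrArg (fun b => ψ (o, b, s.2)) (sub_eq_add_neg _ _)

/-- The initial state `|none, 0, 0⟩`. -/
noncomputable def initialState (ι G : Type*) [Fintype ι] [Fintype G] [AddCommGroup G] (m : ℕ) :
    StateSpace ι G m := by
  classical
  exact EuclideanSpace.single (none, 0, 0) 1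

theorem norm_initialState (m : ℕ) : ‖initialState ι G m‖ = 1 := by
  simp [initialState]

/-- The product `U_T O U_{T-1} O ⋯ O U₀`: a run of an algorithm with gates `U` and oracle `O`. -/
def interleave {H : Type*} [Monoid H] (U : ℕ → H) (O : H) : ℕ → H
  | 0 => U 0
  | T + 1 => U (T + 1) * O * interleave U O T

theorem QueryAlgorithm.state_eq_interleave_initialState (A : QueryAlgorithm ι G) (z : ι → G)
    (T : ℕ) :
    A.state z T = interleave A.gate (oracle A.workSize z) T (initialState ι G A.workSize) := by
  induction T with
  | zero => rfl
  | succ T ih => exact congrArg (fun ψ => A.gate (T + 1) (oracle A.workSize z ψ)) ih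

variable {K D : Type*} [Fintype K] {str : K → ι → D} {M : Matrix K K ℂ} {γ : ℝ}

/-- Weight matrices whose progress grows by at most a factor `1 + 2γ` under each query to the
strings `str x`. -/
def QueryBounded (str : K → ι → D) (M : Matrix K K ℂ) (γ : ℝ) : Prop :=
  M.PosSemidef ∧ ∀ i, GrowthBounded (fun x => str x i) M γ

theorem QueryBounded.progress_oracle_le (h : QueryBounded str M γ) (hγ : 0 ≤ γ) (enc : D → G)
    (m : ℕ) (ψ : K → StateSpace ι G m) :
    progress (fun x => oracle m (fun i => enc (str x i)) (ψ x)) M ≤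
      (1 + 2 * γ) * progress ψ M := by
  rw [progress_eq_sum_progress_slice, progress_eq_sum_progress_slice ψ, Finset.mul_sum]
  refine Finset.sum_le_sum fun o _ => ?_
  cases o with
  | none =>
    simp only [slice_oracle, Option.elim_none]
    rw [progress_map_isometry (answerShift m 0) (fun x => slice none (ψ x)) M]
    exact le_mul_of_one_le_left (progress_nonneg h.1 _) (by linarith)
  | some i =>
    simp only [slice_oracle, Option.elim_some]
    exact (h.2 i).progress_le hγ (fun d => answerShift m (enc d)) fun x => slice (some i) (ψ x)

theorem QueryBounded.progress_interleave_le (h : QueryBounded str M γ) (hγ : 0 ≤ γ) (enc : D → G)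
    {m : ℕ} (U : ℕ → (StateSpace ι G m ≃ₗᵢ[ℂ] StateSpace ι G m)) (ψ : K → StateSpace ι G m)
    (T : ℕ) :
    progress (fun x => interleave U (oracle m fun i => enc (str x i)) T (ψ x)) M ≤
      (1 + 2 * γ) ^ T * progress ψ M := by
  induction T with
  | zero =>
    rw [pow_zero, one_mul]
    exact (progress_map_isometry (U 0) ψ M).le
  | succ T ih =>
    set φ := fun x => interleave U (oracle m fun i => enc (str x i)) T (ψ x)
    calc progress (fun x => U (T + 1) (oracle m (fun i => enc (str x i)) (φ x))) M
        = progress (fun x => oracle m (fun i => enc (str x i)) (φ x)) M :=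
          progress_map_isometry _ _ M
      _ ≤ (1 + 2 * γ) * progress φ M := h.progress_oracle_le hγ enc m φ
      _ ≤ (1 + 2 * γ) * ((1 + 2 * γ) ^ T * progress ψ M) := by gcongr
      _ = (1 + 2 * γ) ^ (T + 1) * progress ψ M := by ring

theorem exists_eq_smul_of_inner_eq {K H : Type*} [NormedAddCommGroup H] [InnerProductSpace ℂ H]
    [Nonempty K] {u : K → ℂ} (hu : ∀ x, ‖u x‖ = 1) {τ : K → H}
    (hτ : ∀ x y, inner ℂ (τ x) (τ y) = star (u x) * u y) :
    ∃ τ₀ : H, ‖τ₀‖ = 1 ∧ ∀ x, τ x = u x • τ₀ := by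
  obtain ⟨x₀⟩ := ‹Nonempty K›
  have hstar x : star (u x) * u x = 1 := star_mul_self_of_norm_eq_one (hu x)
  have hnorm : ∀ x, ‖τ x‖ = 1 := fun x => by
    have h : (‖τ x‖ : ℂ) ^ 2 = 1 := by
      rw [← Complex.coe_algebraMap, ← inner_self_eq_norm_sq_to_K (𝕜 := ℂ), hτ, hstar]
    have h' : ‖τ x‖ ^ 2 = 1 := by exact_mod_cast h
    exact (pow_eq_one_iff_of_nonneg (norm_nonneg _) two_ne_zero).mp h'
  have hnorm₀ : ‖star (u x₀) • τ x₀‖ = 1 := by rw [norm_smul, norm_star, hu, hnorm, one_mul]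
  refine ⟨star (u x₀) • τ x₀, hnorm₀, fun x => ?_⟩
  rw [← inner_eq_one_iff_of_norm_eq_one (𝕜 := ℂ) (hnorm x)
    (by rw [norm_smul, hu, hnorm₀, one_mul]), inner_smul_right, inner_smul_right, hτ]
  linear_combination star (u x₀) * u x₀ * hstar x + hstar x₀

theorem GeneratesCoherently.mul_le_pow_mul {enc : D ↪ G} {u v : K → ℂ} {ε μ : ℝ} {T : ℕ}
    (h : GeneratesCoherently enc str (vecMulVec (star u) u) ε T) (hM : QueryBounded str M γ)
    (hγ : 0 ≤ γ) (hu : ∀ x, ‖u x‖ = 1) (hv : star v ⬝ᵥ v = 1) (hμ : 0 ≤ μ)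
    (hMuv : M *ᵥ (u * v) = μ • (u * v)) :
    μ * (1 - ε) ≤ (1 + 2 * γ) ^ T * (star v ⬝ᵥ M *ᵥ v).re := by
  obtain ⟨A, τ, hτ, hoverlap⟩ := h
  have : Nonempty K := by
    by_contra hK
    rw [not_nonempty_iff] at hK
    simp at hv
  obtain ⟨τ₀, hτ₀, hτu⟩ := exists_eq_smul_of_inner_eq hu hτ
  simp only [hτu, A.state_eq_interleave_initialState] at hoverlap
  set e := initialState ι G A.workSize
  set run := fun x => interleave A.gate (oracle A.workSize fun i => enc (str x i)) T
  calc μ * (1 - ε) ≤ μ * √(1 - ε) ^ 2 := by gcongr; exact (Real.sqrt_le_iff.mp le_rfl).2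
    _ ≤ progress (fun x => v x • run x e) M :=
      mul_sq_le_progress_of_overlap hM.1 hu hv hμ hMuv hτ₀ (Real.sqrt_nonneg _) hoverlap
    _ = progress (fun x => run x (v x • e)) M := by
      simp only [map_smul]
    _ ≤ (1 + 2 * γ) ^ T * progress (fun x => v x • e) M :=
      hM.progress_interleave_le hγ enc A.gate _ T
    _ = (1 + 2 * γ) ^ T * (star v ⬝ᵥ M *ᵥ v).re := by
      rw [progress_smul_const v (norm_initialState A.workSize)]

end Algorithm

/-! ### Adversary matrices -/

section Sign

variable {X : Type*}

/-- The sign `(-1)^a` of a bit `a`, as an additive character. -/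
noncomputable def bitSign : AddChar (ZMod 2) ℂ := AddChar.zmodChar 2 neg_one_sq

theorem bitSign_apply (a : ZMod 2) : bitSign a = (-1) ^ a.val := AddChar.zmodChar_apply _ a

theorem star_bitSign (a : ZMod 2) : star (bitSign a) = bitSign a := by simp [bitSign_apply]

theorem norm_bitSign (a : ZMod 2) : ‖bitSign a‖ = 1 := by simp [bitSign_apply]

theorem bitSign_mul_self (a : ZMod 2) : bitSign a * bitSign a = 1 := by
  rw [← AddChar.map_add_eq_mul, CharTwo.add_self_eq_zero, AddChar.map_zero_eq_one]

theorem bitSign_mul_bitSign (a b : ZMod 2) :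
    bitSign a * bitSign b = if a = b then 1 else -1 := by
  split_ifs with h
  · rw [h, bitSign_mul_self]
  · have hadd : a + b = 1 := by revert a b; decide
    rw [← AddChar.map_add_eq_mul, hadd, bitSign_apply, ZMod.val_one, pow_one]

/-- The vector of signs `(-1)^{f(x)}`. -/
noncomputable def phaseSign (f : X → ZMod 2) : X → ℂ := fun x => bitSign (f x)

theorem norm_phaseSign_apply (f : X → ZMod 2) (x : X) : ‖phaseSign f x‖ = 1 := norm_bitSign (f x)

theorem star_phaseSign (f : X → ZMod 2) : star (phaseSign f) = phaseSign f :=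
  funext fun x => star_bitSign (f x)

theorem phaseSign_mul_self (f : X → ZMod 2) : phaseSign f * phaseSign f = 1 :=
  funext fun x => bitSign_mul_self (f x)

theorem phaseGram_eq_vecMulVec (f : X → ZMod 2) :
    phaseGram f = vecMulVec (star (phaseSign f)) (phaseSign f) := by
  ext x y
  rw [star_phaseSign, vecMulVec_apply, phaseSign, phaseSign, bitSign_apply, bitSign_apply,
    ← pow_add, phaseGram]

theorem tensorPower_phaseGram (k : ℕ) (f : X → ZMod 2) :
    tensorPower k (phaseGram f) =
      vecMulVec (star (tensorPowerVec k (phaseSign f))) (tensorPowerVec k (phaseSign f)) := by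
  rw [phaseGram_eq_vecMulVec, tensorPower_vecMulVec, star_tensorPowerVec]

theorem phaseSign_parityOfCopies (k : ℕ) (f : X → ZMod 2) :
    phaseSign (parityOfCopies k f) = tensorPowerVec k (phaseSign f) :=
  funext fun x =>
    map_prod bitSign.toMonoidHom (fun p => Multiplicative.ofAdd (f (x p))) Finset.univ

theorem phaseGram_parityOfCopies (k : ℕ) (f : X → ZMod 2) :
    phaseGram (parityOfCopies k f) = tensorPower k (phaseGram f) := by
  rw [tensorPower_phaseGram, phaseGram_eq_vecMulVec, phaseSign_parityOfCopies]

theorem allOnes_sub_functionGram (f : X → ZMod 2) :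
    allOnes X - functionGram f = (1 / 2 : ℝ) • (allOnes X - phaseGram f) := by
  ext x y
  rw [phaseGram_eq_vecMulVec, star_phaseSign, Matrix.smul_apply, Matrix.sub_apply,
    Matrix.sub_apply, vecMulVec_apply, phaseSign, phaseSign, bitSign_mul_bitSign, functionGram,
    allOnes]
  split_ifs <;> norm_num

theorem hadamard_allOnes (A : Matrix X X ℂ) : A ⊙ allOnes X = A := by
  ext x y
  exact mul_one _

theorem sub_hadamard (A B C : Matrix X X ℂ) : (A - B) ⊙ C = A ⊙ C - B ⊙ C := by
  ext x y
  exact sub_mul _ _ _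

theorem neg_hadamard (A B : Matrix X X ℂ) : (-A) ⊙ B = -(A ⊙ B) := by
  ext x y
  exact neg_mul _ _

theorem phaseGram_hadamard_self (f : X → ZMod 2) : phaseGram f ⊙ phaseGram f = allOnes X := by
  ext x y
  rw [hadamard_apply, phaseGram, allOnes, ← mul_pow, neg_one_mul, neg_neg, one_pow]

theorem hadamard_allOnes_sub_functionGram_hadamard_phaseGram (Γ : Matrix X X ℂ)
    (f : X → ZMod 2) :
    (Γ ⊙ (allOnes X - functionGram f)) ⊙ phaseGram f = -(Γ ⊙ (allOnes X - functionGram f)) := by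
  have hflip : (allOnes X - phaseGram f) ⊙ phaseGram f = -(allOnes X - phaseGram f) := by
    rw [sub_hadamard, phaseGram_hadamard_self, hadamard_comm, hadamard_allOnes, neg_sub]
  rw [hadamard_assoc, allOnes_sub_functionGram, smul_hadamard, hflip, smul_neg, hadamard_comm,
    neg_hadamard, hadamard_comm]

theorem one_hadamard_phaseGram [DecidableEq X] (f : X → ZMod 2) : 1 ⊙ phaseGram f = 1 := by
  refine one_hadamard_eq_one_iff.mpr (funext fun x => ?_)
  rw [Pi.one_apply, diag_apply, phaseGram, ← two_mul, pow_mul, neg_one_sq, one_pow]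

theorem hadamard_vecMulVec_mulVec [Fintype X] (A : Matrix X X ℂ) (a b v : X → ℂ) :
    (A ⊙ vecMulVec a b) *ᵥ v = a * (A *ᵥ (b * v)) := by
  ext x
  simp only [mulVec, dotProduct, hadamard_apply, vecMulVec_apply, Pi.mul_apply, Finset.mul_sum]
  exact Finset.sum_congr rfl fun y _ => by ring

theorem mulVec_phaseSign_mul [Fintype X] {A : Matrix X X ℂ} {f : X → ZMod 2}
    (hA : A ⊙ phaseGram f = -A) (v : X → ℂ) :
    A *ᵥ (phaseSign f * v) = -(phaseSign f * (A *ᵥ v)) := by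
  rw [← mul_neg, ← neg_mulVec, ← hA, phaseGram_eq_vecMulVec, hadamard_vecMulVec_mulVec,
    star_phaseSign, ← mul_assoc, phaseSign_mul_self, one_mul]

theorem exists_norm_eigenvector [Fintype X] [DecidableEq X] [Nonempty X] {A : Matrix X X ℂ}
    (hA : A.IsHermitian) {f : X → ZMod 2} (hf : A ⊙ phaseGram f = -A) :
    ∃ v : X → ℂ, star v ⬝ᵥ v = 1 ∧ A *ᵥ v = ‖toEuclideanCLM (𝕜 := ℂ) A‖ • v := by
  obtain ⟨v, hv, hAv | hAv⟩ := exists_mulVec_eq_norm_smul_or_neg hA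
  · exact ⟨v, hv, hAv⟩
  · refine ⟨phaseSign f * v, ?_, ?_⟩
    · rw [star_mul_dotProduct_mul_of_norm_eq_one (norm_phaseSign_apply f), hv]
    · rw [mulVec_phaseSign_mul hf, hAv, mul_smul_comm, neg_smul, neg_neg]

end Sign

section Adversary

variable {X ι D : Type*} [DecidableEq X] [DecidableEq D] {str : X → ι → D} {Γ : Matrix X X ℂ}

/-- The constraints on `Γ` in the additive adversary bound. -/
def IsAdversaryMatrix (str : X → ι → D) (Γ : Matrix X X ℂ) : Prop :=
  Γ.IsHermitian ∧ ∀ i : ι,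
    (1 + Γ ⊙ (allOnes X - agreeMatrix str i)).PosSemidef ∧
    (1 - Γ ⊙ (allOnes X - agreeMatrix str i)).PosSemidef

theorem IsAdversaryMatrix.neg (h : IsAdversaryMatrix str Γ) : IsAdversaryMatrix str (-Γ) := by
  refine ⟨h.1.neg, fun i => ?_⟩
  rw [neg_hadamard, sub_neg_eq_add, ← sub_eq_add_neg]
  exact (h.2 i).symm

theorem convex_setOf_isAdversaryMatrix (str : X → ι → D) :
    Convex ℝ {Γ | IsAdversaryMatrix str Γ} := by
  intro Γ hΓ Γ' hΓ' a b ha hb hab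
  have hone : (1 : Matrix X X ℂ) = a • 1 + b • 1 := by rw [← add_smul, hab, one_smul]
  refine ⟨(hΓ.1.smul (.all a)).add (hΓ'.1.smul (.all b)), fun i => ⟨?_, ?_⟩⟩
  · convert ((hΓ.2 i).1.smul ha).add ((hΓ'.2 i).1.smul hb) using 1
    nth_rw 1 [hone, add_hadamard, smul_hadamard, smul_hadamard]
    module
  · convert ((hΓ.2 i).2.smul ha).add ((hΓ'.2 i).2.smul hb) using 1
    nth_rw 1 [hone, add_hadamard, smul_hadamard, smul_hadamard]
    module

theorem IsAdversaryMatrix.hadamard_phaseGram [Finite X] (h : IsAdversaryMatrix str Γ)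
    (f : X → ZMod 2) :
    IsAdversaryMatrix str (Γ ⊙ phaseGram f) := by
  have hσ : (phaseGram f).PosSemidef := by
    rw [phaseGram_eq_vecMulVec]
    exact posSemidef_vecMulVec_star_self _
  refine ⟨h.1.hadamard hσ.1, fun i => ?_⟩
  have hcomm : (Γ ⊙ phaseGram f) ⊙ (allOnes X - agreeMatrix str i) =
      (Γ ⊙ (allOnes X - agreeMatrix str i)) ⊙ phaseGram f := by
    rw [hadamard_assoc, hadamard_comm (phaseGram f), hadamard_assoc]
  rw [hcomm, ← one_hadamard_phaseGram f, ← add_hadamard, ← sub_hadamard]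
  exact ⟨(h.2 i).1.hadamard hσ, (h.2 i).2.hadamard hσ⟩

theorem IsAdversaryMatrix.hadamard_allOnes_sub_functionGram [Finite X]
    (h : IsAdversaryMatrix str Γ) (f : X → ZMod 2) :
    IsAdversaryMatrix str (Γ ⊙ (allOnes X - functionGram f)) := by
  have haverage : Γ ⊙ (allOnes X - functionGram f) =
      (1 / 2 : ℝ) • Γ + (1 / 2 : ℝ) • -(Γ ⊙ phaseGram f) := by
    rw [allOnes_sub_functionGram, hadamard_smul, hadamard_comm, sub_hadamard, hadamard_comm,
      hadamard_allOnes, hadamard_comm, sub_eq_add_neg, smul_add]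
  rw [haverage]
  exact convex_setOf_isAdversaryMatrix str h (h.hadamard_phaseGram f).neg (by norm_num)
    (by norm_num) (by norm_num)

variable [Fintype X] {A : Matrix X X ℂ} {γ : ℝ}

/-- The multiplicative adversary matrix `I + γ (‖A‖ I - A)` built from an additive one. -/
noncomputable def multAdversary (γ : ℝ) (A : Matrix X X ℂ) : Matrix X X ℂ :=
  1 + γ • (‖toEuclideanCLM (𝕜 := ℂ) A‖ • 1 - A)

theorem posSemidef_multAdversary (hA : A.IsHermitian) (hγ : 0 ≤ γ) :
    (multAdversary γ A).PosSemidef :=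
  PosSemidef.one.add ((posSemidef_norm_smul_one_sub hA).smul hγ)

theorem multAdversary_mulVec {v : X → ℂ} {c : ℝ} (hv : A *ᵥ v = c • v) (γ : ℝ) :
    multAdversary γ A *ᵥ v = (1 + γ * (‖toEuclideanCLM (𝕜 := ℂ) A‖ - c)) • v := by
  rw [multAdversary, add_mulVec, smul_mulVec, sub_mulVec, smul_mulVec, one_mulVec, hv, ← sub_smul,
    smul_smul, add_smul, one_smul]

theorem IsAdversaryMatrix.queryBounded_tensorPower_multAdversary (h : IsAdversaryMatrix str A)
    (hγ : 0 ≤ γ) (k : ℕ) :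
    QueryBounded (tupleString k str) (tensorPower k (multAdversary γ A)) γ := by
  have hM := posSemidef_multAdversary h.1 hγ
  set M := multAdversary γ A with hMdef
  refine ⟨posSemidef_tensorPower hM k, fun ⟨p, j⟩ => ?_⟩
  set B := A ⊙ (allOnes X - agreeMatrix str j) with hB
  have hadd : (γ • 1 + γ • B).PosSemidef := smul_add γ 1 B ▸ (h.2 j).1.smul hγ
  have hsub : (γ • 1 - γ • B).PosSemidef := smul_sub γ 1 B ▸ (h.2 j).2.smul hγ
  have hMB : ∀ a b, str a j ≠ str b j → (1 : Matrix X X ℂ) a b = 0 ∧ M a b = -(γ • B) a b := by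
    intro a b hab
    have hne : a ≠ b := fun hab' => hab (by rw [hab'])
    simp [hMdef, hB, multAdversary, hne, allOnes, agreeMatrix, hab]
  refine ⟨tensorReplace p M 1, -tensorReplace p M (γ • B), ?_, ?_, ?_, fun x y hxy => ⟨?_, ?_⟩⟩
  · rw [← tensorReplace_self p, ← map_sub]
    refine posSemidef_tensorReplace hM ?_ p
    rw [hMdef, multAdversary, add_sub_cancel_left]
    exact (posSemidef_norm_smul_one_sub h.1).smul hγ
  · rw [← sub_eq_add_neg, ← map_smul, ← map_sub]
    exact posSemidef_tensorReplace hM hsub p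
  · rw [sub_neg_eq_add, ← map_smul, ← map_add]
    exact posSemidef_tensorReplace hM hadd p
  · rw [tensorReplace_apply, (hMB _ _ hxy).1, zero_mul]
  · rw [← tensorReplace_self p, ← map_neg, tensorReplace_apply, tensorReplace_apply,
      (hMB _ _ hxy).2, Matrix.neg_apply]

end Adversary

/-! ### The strong direct product theorem -/

section StrongDirectProduct

theorem mul_le_of_forall_pow_mul_le_pow {a δ : ℝ} (ha : 0 ≤ a) (hδ : 0 ≤ δ) {k T : ℕ}
    (h : ∀ γ : ℝ, 0 ≤ γ → (1 + 2 * γ * a) ^ k * δ ^ k ≤ (1 + 2 * γ) ^ T) :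
    k * δ / 4 * a ≤ T := by
  obtain rfl | hk := eq_or_ne k 0
  · simp
  obtain rfl | ha := ha.eq_or_lt
  · simp
  obtain rfl | hδ := hδ.eq_or_lt
  · simp
  have hδ_one : δ ≤ 1 := (pow_le_one_iff_of_nonneg hδ.le hk).mp (by simpa using h 0 le_rfl)
  have hexp_le : Real.exp 1 ≤ 4 := by linarith [Real.exp_one_lt_three]
  obtain ⟨γ, hγ⟩ : ∃ γ : ℝ, (1 + 2 * γ * a) * δ = Real.exp 1 :=
    ⟨(Real.exp 1 / δ - 1) / (2 * a), by field_simp; ring⟩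
  have hγ_nonneg : 0 ≤ γ := by
    by_contra! hneg
    nlinarith [Real.one_le_exp zero_le_one, mul_pos ha hδ]
  have hle : (k : ℝ) ≤ T * (2 * γ) := by
    rw [← Real.exp_le_exp]
    calc Real.exp k = (1 + 2 * γ * a) ^ k * δ ^ k := by
          rw [← mul_pow, hγ, ← Real.exp_nat_mul, mul_one]
      _ ≤ (1 + 2 * γ) ^ T := h γ hγ_nonneg
      _ ≤ Real.exp (2 * γ) ^ T := by
        gcongr
        linarith [Real.add_one_le_exp (2 * γ)]
      _ = Real.exp (T * (2 * γ)) := (Real.exp_nat_mul _ T).symm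
  calc k * δ / 4 * a ≤ T * (2 * γ) * δ / 4 * a := by gcongr
    _ = T * (2 * γ * a * δ / 4) := by ring
    _ ≤ T * 1 := by
      gcongr
      linarith
    _ = T := mul_one _

variable {X ι D G : Type*} [Fintype X] [DecidableEq X] [Fintype ι] [DecidableEq D] [Fintype G]
  [AddCommGroup G] {enc : D ↪ G} {str : X → ι → D} {f : X → ZMod 2} {k T : ℕ}

theorem GeneratesCoherently.pow_mul_le_pow [Nonempty X] {ε γ : ℝ}
    (h : GeneratesCoherently enc (tupleString k str) (tensorPower k (phaseGram f)) ε T)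
    {A : Matrix X X ℂ} (hA : IsAdversaryMatrix str A) (hAf : A ⊙ phaseGram f = -A)
    (hγ : 0 ≤ γ) :
    (1 + 2 * γ * ‖toEuclideanCLM (𝕜 := ℂ) A‖) ^ k * (1 - ε) ≤ (1 + 2 * γ) ^ T := by
  set a := ‖toEuclideanCLM (𝕜 := ℂ) A‖
  set M := multAdversary γ A
  obtain ⟨v, hv, hAv⟩ := exists_norm_eigenvector hA.1 hAf
  have hMv : M *ᵥ v = v := by
    rw [multAdversary_mulVec hAv, sub_self, mul_zero, add_zero, one_smul]
  have hAflip : A *ᵥ (phaseSign f * v) = -a • (phaseSign f * v) := by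
    rw [mulVec_phaseSign_mul hAf, hAv, mul_smul_comm, neg_smul]
  have hMflip : M *ᵥ (phaseSign f * v) = (1 + 2 * γ * a) • (phaseSign f * v) := by
    rw [multAdversary_mulVec hAflip]
    congr 1
    ring
  rw [tensorPower_phaseGram] at h
  have key := h.mul_le_pow_mul (v := tensorPowerVec k v) (μ := (1 + 2 * γ * a) ^ k)
    (hA.queryBounded_tensorPower_multAdversary hγ k) hγ
    (norm_tensorPowerVec_apply (norm_phaseSign_apply f))
    (by rw [star_tensorPowerVec, tensorPowerVec_dotProduct_tensorPowerVec, hv, one_pow])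
    (by positivity)
    (by rw [← tensorPowerVec_mul, tensorPower_mulVec_tensorPowerVec, hMflip, tensorPowerVec_smul])
  rwa [tensorPower_mulVec_tensorPowerVec, hMv, star_tensorPowerVec,
    tensorPowerVec_dotProduct_tensorPowerVec, hv, one_pow, Complex.one_re, mul_one] at key

theorem GeneratesCoherently.mul_norm_le {δ : ℝ} (hδ : 0 ≤ δ)
    (h : GeneratesCoherently enc (tupleString k str) (tensorPower k (phaseGram f)) (1 - δ ^ k) T)
    {Γ : Matrix X X ℂ} (hΓ : IsAdversaryMatrix str Γ) :
    k * δ / 4 * ‖toEuclideanCLM (𝕜 := ℂ) (Γ ⊙ (allOnes X - functionGram f))‖ ≤ T := by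
  obtain hX | hX := isEmpty_or_nonempty X
  · simp [Subsingleton.elim (Γ ⊙ (allOnes X - functionGram f)) 0]
  refine mul_le_of_forall_pow_mul_le_pow (norm_nonneg _) hδ fun γ hγ => ?_
  rw [← sub_sub_cancel 1 (δ ^ k)]
  exact h.pow_mul_le_pow (hΓ.hadamard_allOnes_sub_functionGram f)
    (hadamard_allOnes_sub_functionGram_hadamard_phaseGram Γ f) hγ

theorem mul_additiveAdversary_le_coherentQuery (enc : D ↪ G) (str : X → ι → D) (f : X → ZMod 2)
    {δ : ℝ} (hδ : 0 ≤ δ) (k : ℕ) :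
    (k : ℝ≥0∞) * ENNReal.ofReal δ / 4 * additiveAdversary str (functionGram f) ≤
      (coherentQuery enc (tupleString k str) (tensorPower k (phaseGram f)) (1 - δ ^ k) :
        ℝ≥0∞) := by
  have hcoef : (k : ℝ≥0∞) * ENNReal.ofReal δ / 4 = ENNReal.ofReal (k * δ / 4) := by
    rw [ENNReal.ofReal_div_of_pos four_pos, ENNReal.ofReal_mul k.cast_nonneg,
      ENNReal.ofReal_natCast, ENNReal.ofReal_ofNat]
  simp only [coherentQuery, additiveAdversary, ENat.toENNReal_iInf, ENNReal.mul_iSup, le_iInf_iff,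
    iSup_le_iff]
  intro T hT Γ hΓ
  rw [hcoef, ← ENNReal.ofReal_mul (by positivity), ENat.toENNReal_coe, ← ENNReal.ofReal_natCast]
  exact ENNReal.ofReal_le_ofReal (hT.mul_norm_le hδ hΓ)

end StrongDirectProduct

/-! ### From computing a bit to computing it in the phase -/

section Uncompute

variable {S : Type*} [Fintype S]

/-- The diagonal unitary `|s⟩ ↦ (-1)^{out(s)} |s⟩`. -/
noncomputable def phaseFlip (out : S → ZMod 2) : EuclideanSpace ℂ S ≃ₗᵢ[ℂ] EuclideanSpace ℂ S :=
  LinearIsometryEquiv.piLpCongrRight 2 fun s =>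
    if out s = 0 then LinearIsometryEquiv.refl ℂ ℂ else LinearIsometryEquiv.neg ℂ

theorem phaseFlip_apply (out : S → ZMod 2) (ψ : EuclideanSpace ℂ S) (s : S) :
    phaseFlip out ψ s = bitSign (out s) * ψ s := by
  have happly : phaseFlip out ψ s =
      (if out s = 0 then LinearIsometryEquiv.refl ℂ ℂ else LinearIsometryEquiv.neg ℂ) (ψ s) := rfl
  obtain h | h : out s = 0 ∨ out s = 1 := by
    generalize out s = a
    revert a
    decide
  · simp [happly, h]
  · simp [happly, h, bitSign_apply, ZMod.val_one]

theorem re_inner_phaseFlip_bitSign_smul (out : S → ZMod 2) {ψ : EuclideanSpace ℂ S}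
    (hψ : ‖ψ‖ = 1) (a : ZMod 2) :
    (inner ℂ (phaseFlip out ψ) (bitSign a • ψ)).re = 2 * ∑ s with out s = a, ‖ψ s‖ ^ 2 - 1 := by
  have hsum : ∑ s, ‖ψ s‖ ^ 2 = 1 := by rw [← EuclideanSpace.norm_sq_eq, hψ, one_pow]
  have hterm s : (inner ℂ (phaseFlip out ψ s) ((bitSign a • ψ) s)).re =
      2 * (if out s = a then ‖ψ s‖ ^ 2 else 0) - ‖ψ s‖ ^ 2 := by
    have hmul : inner ℂ (phaseFlip out ψ s) ((bitSign a • ψ) s) =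
        bitSign (out s) * bitSign a * (‖ψ s‖ ^ 2 : ℝ) := by
      rw [phaseFlip_apply, RCLike.inner_apply', PiLp.smul_apply, smul_eq_mul, map_mul,
        ← Complex.star_def, star_bitSign, ← Complex.normSq_eq_norm_sq,
        Complex.normSq_eq_conj_mul_self, Complex.star_def]
      ring
    rw [hmul, bitSign_mul_bitSign, Complex.re_mul_ofReal]
    split_ifs
    · rw [Complex.one_re]
      ring
    · rw [Complex.neg_re, Complex.one_re]
      ring
  rw [PiLp.inner_apply, Complex.re_sum, Finset.sum_congr rfl fun s _ => hterm s,
    Finset.sum_sub_distrib, ← Finset.mul_sum, Finset.sum_filter, hsum]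

variable {ι G : Type*} [Fintype ι] [Fintype G] [AddCommGroup G]

/-- The unitary `|i, b, w⟩ ↦ |i, -b, w⟩`. Conjugating the oracle with it gives its inverse. -/
noncomputable def negateAnswer (ι G : Type*) [Fintype ι] [Fintype G] [AddCommGroup G] (m : ℕ) :
    StateSpace ι G m ≃ₗᵢ[ℂ] StateSpace ι G m :=
  LinearIsometryEquiv.piLpCongrLeft 2 ℂ ℂ
    ((Equiv.refl (Option ι)).prodCongr ((Equiv.neg G).prodCongr (Equiv.refl (Fin (m + 1)))))

theorem negateAnswer_mul_oracle_mul_negateAnswer (m : ℕ) (z : ι → G) :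
    negateAnswer ι G m * oracle m z * negateAnswer ι G m = (oracle m z)⁻¹ := by
  refine eq_inv_of_mul_eq_one_left (LinearIsometryEquiv.ext fun ψ => PiLp.ext fun s => ?_)
  have hanswer : -(-s.2.1 - s.1.elim 0 z) - s.1.elim 0 z = s.2.1 := by abel
  exact congrArg (fun b => ψ (s.1, b, s.2.2)) hanswer

section Group

variable {H : Type*} [Group H] (U : ℕ → H) (N V : H) (T : ℕ)

/-- The gates of the algorithm which makes `T` queries with the gates `U`, applies `V`, and runs
backwards. An inverse query is made as a query between two applications of `N`. -/
def uncomputeGate (t : ℕ) : H :=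
  if t < T then U t
  else if t = T then N * (U T)⁻¹ * V * U T
  else N * (U (2 * T - t))⁻¹ * N

variable (O : H)

theorem interleave_uncomputeGate_of_lt {t : ℕ} (ht : t < T) :
    interleave (uncomputeGate U N V T) O t = interleave U O t := by
  induction t with
  | zero => exact if_pos ht
  | succ t ih => rw [interleave, ih (by lia), uncomputeGate, if_pos ht, interleave]

theorem interleave_uncomputeGate_self :
    interleave (uncomputeGate U N V T) O T = N * (U T)⁻¹ * V * interleave U O T := by
  cases T with
  | zero => simp [interleave, uncomputeGate]
  | succ T =>
    rw [interleave, interleave_uncomputeGate_of_lt U N V (T + 1) O T.lt_succ_self, interleave,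
      uncomputeGate, if_neg (lt_irrefl _), if_pos rfl]
    simp only [mul_assoc]

variable {U N V T O}

theorem interleave_uncomputeGate_add (hN : N * O * N = O⁻¹) {s r : ℕ} (hT : s + r = T) :
    interleave (uncomputeGate U N V T) O (T + s) =
      N * (U r)⁻¹ * interleave U O r * (interleave U O T)⁻¹ * V * interleave U O T := by
  induction s generalizing r with
  | zero =>
    obtain rfl : r = T := by lia
    rw [mul_inv_cancel_right, add_zero, interleave_uncomputeGate_self]
  | succ s ih =>
    have hlt : ¬ T + s + 1 < T := by lia
    have hne : ¬ T + s + 1 = T := by lia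
    have hr : 2 * T - (T + s + 1) = r := by lia
    have hNO : N * O * N * O = 1 := by rw [hN, inv_mul_cancel]
    rw [← add_assoc, interleave, ih (r := r + 1) (by lia), uncomputeGate, if_neg hlt, if_neg hne,
      hr, interleave]
    calc N * (U r)⁻¹ * N * O * (N * (U (r + 1))⁻¹ * (U (r + 1) * O * interleave U O r) *
          (interleave U O T)⁻¹ * V * interleave U O T)
        = N * (U r)⁻¹ * (N * O * N * O) * interleave U O r * (interleave U O T)⁻¹ * V *
          interleave U O T := by group
      _ = N * (U r)⁻¹ * interleave U O r * (interleave U O T)⁻¹ * V * interleave U O T := by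
        rw [hNO, mul_one]

theorem interleave_uncomputeGate_two_mul (hN : N * O * N = O⁻¹) :
    interleave (uncomputeGate U N V T) O (2 * T) =
      N * (interleave U O T)⁻¹ * V * interleave U O T := by
  rw [two_mul, interleave_uncomputeGate_add hN (add_zero T), interleave, inv_mul_cancel_right]

end Group

variable {X D : Type*} {enc : D ↪ G} {str : X → ι → D} {g : X → ZMod 2} {c : ℝ}

theorem ComputesWithError.generatesCoherently (hc : 0 ≤ c) {T : ℕ}
    (h : ComputesWithError enc str g ((1 - c) / 2) T) :
    GeneratesCoherently enc str (phaseGram g) (1 - c ^ 2) (2 * T) := by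
  obtain ⟨⟨m, U⟩, out, hout⟩ := h
  set N := negateAnswer ι G m
  set e := initialState ι G m
  have hnorm : ‖N e‖ = 1 := by rw [LinearIsometryEquiv.norm_map, norm_initialState]
  refine ⟨⟨m, uncomputeGate U N (phaseFlip out) T⟩, fun x => bitSign (g x) • N e, fun x y => ?_,
    fun x => ?_⟩
  · rw [phaseGram_eq_vecMulVec, vecMulVec_apply, inner_smul_left, inner_smul_right,
      inner_self_eq_norm_sq_to_K, hnorm, RCLike.ofReal_one, one_pow, mul_one]
    rfl
  set z := fun i => enc (str x i)
  set R := interleave U (oracle m z) T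
  have hfinal : interleave (uncomputeGate U N (phaseFlip out) T) (oracle m z) (2 * T) e =
      N (R⁻¹ (phaseFlip out (R e))) := by
    rw [interleave_uncomputeGate_two_mul (negateAnswer_mul_oracle_mul_negateAnswer m z)]
    rfl
  have hoverlap : inner ℂ (N (R⁻¹ (phaseFlip out (R e)))) (bitSign (g x) • N e) =
      inner ℂ (phaseFlip out (R e)) (bitSign (g x) • R e) := by
    rw [← map_smul, LinearIsometryEquiv.inner_map_map, ← map_smul R]
    exact LinearIsometryEquiv.inner_map_eq_flip R.symm _ _
  have hRe : ‖R e‖ = 1 := by rw [LinearIsometryEquiv.norm_map, norm_initialState]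
  have hprob := hout x
  rw [QueryAlgorithm.state_eq_interleave_initialState] at hprob ⊢
  rw [sub_sub_cancel, Real.sqrt_sq hc, hfinal, hoverlap, re_inner_phaseFlip_bitSign_smul out hRe]
  linarith

theorem coherentQuery_phaseGram_le_two_mul_quantumQuery (hc : 0 ≤ c) :
    coherentQuery enc str (phaseGram g) (1 - c ^ 2) ≤
      2 * quantumQuery enc str g ((1 - c) / 2) := by
  simp only [quantumQuery, ENat.mul_iInf_of_ne two_ne_zero, le_iInf_iff]
  intro T hT
  exact (iInf₂_le (2 * T) (hT.generatesCoherently hc)).trans_eq (by push_cast; rfl)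

end Uncompute

end

theorem mainTheorem6_general {X ι D G : Type*} [Fintype X] [DecidableEq X] [Fintype ι]
    [DecidableEq D] [Fintype G] [AddCommGroup G] (enc : D ↪ G) (str : X → ι → D)
    (f : X → ZMod 2) {δ : ℝ} (hδ : 0 ≤ δ) (k : ℕ) :
    (k : ℝ≥0∞) * ENNReal.ofReal δ / 4 * additiveAdversary str (functionGram f) ≤
      (coherentQuery enc (tupleString k str) (tensorPower k (phaseGram f)) (1 - δ ^ k) :
        ℝ≥0∞) ∧
    (k : ℝ≥0∞) * ENNReal.ofReal δ / 8 * additiveAdversary str (functionGram f) ≤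
      (quantumQuery enc (tupleString k str) (parityOfCopies k f)
        ((1 - δ ^ ((k : ℝ) / 2)) / 2) : ℝ≥0∞) := by
  have hcoherent := mul_additiveAdversary_le_coherentQuery enc str f hδ k
  refine ⟨hcoherent, ?_⟩
  have hsq : (δ ^ ((k : ℝ) / 2)) ^ 2 = δ ^ k := by
    rw [← Real.rpow_mul_natCast hδ, Nat.cast_ofNat, div_mul_cancel₀ _ two_ne_zero,
      Real.rpow_natCast]
  have hquery := coherentQuery_phaseGram_le_two_mul_quantumQuery (enc := enc)
    (str := tupleString k str) (g := parityOfCopies k f) (Real.rpow_nonneg hδ ((k : ℝ) / 2))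
  rw [hsq, phaseGram_parityOfCopies, ← ENat.toENNReal_le, ENat.toENNReal_mul] at hquery
  have hdouble (a : ℝ≥0∞) : 2 * (a / 8) = a / 4 := by
    rw [← mul_div_assoc, show (8 : ℝ≥0∞) = 2 * 4 by norm_num,
      ENNReal.mul_div_mul_left _ _ two_ne_zero ENNReal.ofNat_ne_top]
  refine (ENNReal.mul_le_mul_iff_right two_ne_zero ENNReal.ofNat_ne_top).mp ?_
  rw [← mul_assoc, hdouble]
  exact hcoherent.trans hquery

theorem mainTheorem6 {D G : Type*} [Finite D] [DecidableEq D] [Fintype G] [AddCommGroup G]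
    (enc : D ↪ G) (n : ℕ) (𝒟 : Finset (Fin n → D)) (f : 𝒟 → ZMod 2)
    (δ : ℝ) (hδ0 : 0 ≤ δ) (hδ1 : δ ≤ 1) (k : ℕ) (hk : 0 < k) :
    (k : ℝ≥0∞) * ENNReal.ofReal δ / 4 *
        additiveAdversary (fun x : 𝒟 => x.val) (functionGram f) ≤
      (coherentQuery enc (tupleString k (fun x : 𝒟 => x.val)) (tensorPower k (phaseGram f))
        (1 - δ ^ k) : ℝ≥0∞) ∧
    (k : ℝ≥0∞) * ENNReal.ofReal δ / 8 *
        additiveAdversary (fun x : 𝒟 => x.val) (functionGram f) ≤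
      (quantumQuery enc (tupleString k (fun x : 𝒟 => x.val)) (parityOfCopies k f)
        ((1 - δ ^ ((k : ℝ) / 2)) / 2) : ℝ≥0∞) :=
  mainTheorem6_general enc _ f hδ0 k
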